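/- Let $\mathbb F=\mathbb R$ or $\mathbb C$, let $W\subset\mathbb F$, let $\mathcal B$ be a $\sigma$-algebra on $W$ containing the Borel sets of $W$, and let $\mu$ be a $\sigma$-finite measure on $(W,\mathcal B)$. Assume that there is $c:W\to\mathbb F$ with $|x-y|^2=c(x)c(y)(x-y)^2$ for all $x,y\in W$ (for instance $c=1$ if $W\subset\mathbb R$, and $c(x)=i/x$ if $W$ is the unit circle). Let $L$ be an even positive integer, $\beta=L^2$, let $1\le m\le M$ be integers, $M'=M-m$, $N'=LM'$, and let $w:W\to[0,\infty)$ be measurable with $$0<Z:=\frac1{M!}\int_{W^M}\prod_{j<k}|x_k-x_j|^\beta\prod_{\ell=1}^M w(x_\ell)\,d\mu^M(\mathbf x)<\infty .$$ The $\beta$-ensemble is the point process of $M$ particles in $W$ whose joint density with respect to $\mu^M$ is $$f(\mathbf x)=\frac1{M!\,Z}\prod_{j<k}|x_k-x_j|^\beta\prod_{\ell=1}^M w(x_\ell).$$ For $B\in\mathcal B$ let $N_B$ be the number of particles in $B$. An $m$-th correlation function is a measurable $R:W^m\to[0,\infty)$ such that $\mathbb E[N_{B_1}\cdots N_{B_m}]=\int_{B_1\times\cdots\times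 B_m}R\,d\mu^m$ for all pairwise disjoint $B_1,\dots,B_m\in\mathcal B$. Put $$R_m(\mathbf y)=\frac{M!}{M'!}\int_{W^{M'}}f(y_1,\dots,y_m,x_1,\dots,x_{M'})\,d\mu^{M'}(\mathbf x),\qquad u(x)=c(x)^{(M-1)\beta/2}\,w(x).$$ Let $p_0,\dots,p_{N'-1}\in\mathbb F[x]$ be any monic polynomials with $\deg p_n=n$. For $\mathfrak u=\{\mathfrak u(0)<\dots<\mathfrak u(L-1)\}\subset\{0,\dots,N'-1\}$ let $\mathrm{Wr}(\mathbf p_{\mathfrak u};x)=\det\big[\tfrac1{\ell!}p^{(\ell)}_{\mathfrak u(k)}(x)\big]_{\ell,k=0}^{L-1}$ and $\mathbf e_{\mathfrak u}=\mathbf e_{\mathfrak u(0)}\wedge\dots\wedge\mathbf e_{\mathfrak u(L-1)}$, where $\mathbf e_0,\dots,\mathbf e_{N'-1}$ is the standard basis of $\mathbb F^{N'}$. For $\omega\in\Lambda^L\mathbb F^{N'}$ let the hyperpfaffian $\mathrm{PF}(\omega)$ be the coefficient of $\mathbf e_0\wedge\dots\wedge\mathbf e_{N'-1}$ in $\omega^{\wedge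 M'}/M'!$. For $\mathbf y\in W^m$ let $$\gamma_{\mathbf y}=\sum_{\mathfrak u}\bigg(\int_W\prod_{j=1}^m(x-y_j)^\beta\;\mathrm{Wr}(\mathbf p_{\mathfrak u};x)\,u(x)\,d\mu(x)\bigg)\mathbf e_{\mathfrak u}\in\Lambda^L\mathbb F^{N'},$$ the sum being over all $L$-element subsets $\mathfrak u$ of $\{0,\dots,N'-1\}$. Then, for every $\mathbf y\in W^m$, the integrals defining $R_m(\mathbf y)$ and $\gamma_{\mathbf y}$ converge absolutely; $R_m$ is an $m$-th correlation function of the ensemble; and for every $\mathbf y\in W^m$ $$R_m(\mathbf y)=\frac1Z\prod_{1\le j<k\le m}(y_k-y_j)^\beta\cdot\prod_{n=1}^m u(y_n)\cdot\mathrm{PF}(\gamma_{\mathbf y}).$$ Moreover, every $m$-th correlation function of the ensemble is equal to the right-hand side at $\mu^m$-almost every $\mathbf y$ with pairwise distinct coordinates. -/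

import Mathlib

open MeasureTheory
open scoped ENNReal Nat

noncomputable section

/-! ### Point processes and correlation functions -/

open Classical in
/-- `N_B(x)`: the number of coordinates of `x ∈ X^M` that lie in `B`. -/
def occupation {X : Type*} {M : ℕ} (B : Set X) (x : Fin M → X) : ℕ :=
  (Finset.univ.filter fun i => x i ∈ B).card

/-- `R : X^m → [0, ∞)` is an `m`-th correlation function, with respect to the reference measure
`μ` on `X`, of the `M`-particle point process on `X` with law `P`: for pairwise disjoint measurable
sets `B_1, …, B_m`, the expectation of `N_{B_1} ⋯ N_{B_m}` is the integral of `R` with respect to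
`μ^m` over `B_1 × ⋯ × B_m`. -/
structure IsCorrelationFunction {X : Type*} [MeasurableSpace X] (μ : Measure X) {M : ℕ}
    (P : Measure (Fin M → X)) (m : ℕ) (R : (Fin m → X) → ℝ) : Prop where
  measurable : Measurable R
  nonneg : ∀ y, 0 ≤ R y
  expectation : ∀ B : Fin m → Set X, (∀ i, MeasurableSet (B i)) →
    (Pairwise fun i j => Disjoint (B i) (B j)) →
    ∫⁻ x, ∏ i, (occupation (B i) x : ℝ≥0∞) ∂P =
      ∫⁻ y in Set.univ.pi B, ENNReal.ofReal (R y) ∂(Measure.pi fun _ => μ)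

/-! ### β-ensembles -/

section Ensemble

variable {𝕜 : Type*} [RCLike 𝕜] {W : Set 𝕜}

/-- The unnormalized joint density
`∏_{j<k} |x_k - x_j|^β · ∏_l w(x_l)` of `M` particles in `W`. -/
def betaWeight (β : ℕ) (w : W → ℝ) {M : ℕ} (x : Fin M → W) : ℝ :=
  (∏ j, ∏ k ∈ Finset.Ioi j, ‖(x k : 𝕜) - (x j : 𝕜)‖ ^ β) * ∏ l, w (x l)

variable [MeasurableSpace W]

/-- The partition function `Z = (1/M!) ∫_{W^M} ∏_{j<k} |x_k - x_j|^β ∏_l w(x_l) dμ^M(x)`. -/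
def partitionFunction (β : ℕ) (w : W → ℝ) (μ : Measure W) (M : ℕ) : ℝ :=
  (M ! : ℝ)⁻¹ * ∫ x : Fin M → W, betaWeight β w x ∂(Measure.pi fun _ => μ)

/-- The joint density
`f(x) = (1 / (M! Z)) ∏_{j<k} |x_k - x_j|^β ∏_l w(x_l)` with respect to `μ^M`. -/
def jointDensity (β : ℕ) (w : W → ℝ) (μ : Measure W) {M : ℕ} (x : Fin M → W) : ℝ :=
  ((M ! : ℝ) * partitionFunction β w μ M)⁻¹ * betaWeight β w x

/-- The law on `W^M` of the `β`-ensemble of `M` particles with weight `w`. -/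
def betaEnsemble (β : ℕ) (w : W → ℝ) (μ : Measure W) (M : ℕ) : Measure (Fin M → W) :=
  (Measure.pi fun _ => μ).withDensity fun x => ENNReal.ofReal (jointDensity β w μ x)

/-- The `m`-th correlation function of the `β`-ensemble of `M = m + M'` particles as a marginal
density: `R_m(y) = (M! / M'!) ∫_{W^{M'}} f(y_1, …, y_m, x_1, …, x_{M'}) dμ^{M'}(x)`. -/
def betaCorrelation (β : ℕ) (w : W → ℝ) (μ : Measure W) (m M' : ℕ) (y : Fin m → W) : ℝ :=
  ((m + M')! : ℝ) / (M' ! : ℝ) *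
    ∫ x : Fin M' → W, jointDensity β w μ (Fin.append y x) ∂(Measure.pi fun _ => μ)

/-- The modified weight `u(x) = c(x)^{(M-1)β/2} w(x)` (used for `β` even and `M ≥ 1`). -/
def modifiedWeight (β M : ℕ) (c : W → 𝕜) (w : W → ℝ) (x : W) : 𝕜 :=
  c x ^ ((M - 1) * (β / 2)) * (w x : 𝕜)

end Ensemble

/-! ### Hyperpfaffians and Wronskians -/

section Hyperpfaffian

variable {𝕜 : Type*} [Field 𝕜]

/-- The Hodge star on the determinantal line of `Λ 𝕜^N`: the coefficient of
`e_0 ∧ ⋯ ∧ e_{N-1}` in the basis of the exterior algebra induced by the standard basis. -/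
def volumeCoeff {N : ℕ} (α : ExteriorAlgebra 𝕜 (Fin N → 𝕜)) : 𝕜 :=
  (Pi.basisFun 𝕜 (Fin N)).ExteriorAlgebra.repr α Finset.univ

/-- The hyperpfaffian `PF(ω) = ∗ (ω^{∧ M} / M!)` of an `L`-vector `ω ∈ Λ^L 𝕜^{LM}`. -/
def hyperpfaffian {L M : ℕ} (ω : ⋀[𝕜]^L (Fin (L * M) → 𝕜)) : 𝕜 :=
  volumeCoeff ((M ! : 𝕜)⁻¹ • (ω : ExteriorAlgebra 𝕜 (Fin (L * M) → 𝕜)) ^ M)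

/-- A complete family of monic polynomials: `p_n` is monic of degree `n` for `0 ≤ n < N`. -/
def IsCompleteMonicFamily {N : ℕ} (p : Fin N → Polynomial 𝕜) : Prop :=
  ∀ n, (p n).Monic ∧ (p n).natDegree = n

/-- The renormalized Wronskian `Wr(p_t; x) = det [D^ℓ p_{t(k)}(x)]_{ℓ,k=0}^{L-1}`, where
`t(0) < ⋯ < t(L-1)` are the elements of the `L`-subset `t` of `{0, …, N-1}` and
`D^ℓ = (1/ℓ!) d^ℓ/dx^ℓ` (the Hasse derivative). -/
def wronskian {N L : ℕ} (p : Fin N → Polynomial 𝕜) (t : Set.powersetCard (Fin N) L) (x : 𝕜) : 𝕜 :=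
  Matrix.det (Matrix.of fun ℓ k : Fin L =>
    (Polynomial.hasseDeriv ℓ (p (Set.powersetCard.ofFinEmbEquiv.symm t k))).eval x)

end Hyperpfaffian

/-! ### The `L`-vector `γ_y` -/

section Gram

variable {𝕜 : Type*} [RCLike 𝕜] {W : Set 𝕜}

/-- The integrand `∏_j (x - y_j)^β · Wr(p_t; x) · u(x)` of the coefficients of `γ_y`. -/
def gramIntegrand (β : ℕ) (u : W → 𝕜) {N L m : ℕ} (p : Fin N → Polynomial 𝕜) (y : Fin m → W)
    (t : Set.powersetCard (Fin N) L) (x : W) : 𝕜 :=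
  (∏ j, ((x : 𝕜) - (y j : 𝕜)) ^ β) * wronskian p t (x : 𝕜) * u x

/-- `γ_y = ∑_t (∫_W ∏_j (x - y_j)^β Wr(p_t; x) u(x) dμ(x)) e_t ∈ Λ^L 𝕜^N`, the sum being over
the `L`-subsets `t` of `{0, …, N-1}`. -/
def gramVector [MeasurableSpace W] (β : ℕ) (u : W → 𝕜) (μ : Measure W) {N m : ℕ} (L : ℕ)
    (p : Fin N → Polynomial 𝕜) (y : Fin m → W) : ⋀[𝕜]^L (Fin N → 𝕜) :=
  ∑ t : Set.powersetCard (Fin N) L,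
    (∫ x, gramIntegrand β u p y t x ∂μ) •
      exteriorPower.ιMulti_family 𝕜 L (Pi.basisFun 𝕜 (Fin N)) t

/-- The right-hand side
`(1/Z) ∏_{j<k} (y_k - y_j)^β · ∏_n u(y_n) · PF(γ_y)`, for `β = L^2` and `M = m + M'`
particles. -/
def hyperpfaffianCorrelation [MeasurableSpace W] (L : ℕ) (c : W → 𝕜) (w : W → ℝ) (μ : Measure W)
    (m M' : ℕ) (p : Fin (L * M') → Polynomial 𝕜) (y : Fin m → W) : 𝕜 :=
  ((partitionFunction (L ^ 2) w μ (m + M') : ℝ) : 𝕜)⁻¹ *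
    (∏ j, ∏ k ∈ Finset.Ioi j, ((y k : 𝕜) - (y j : 𝕜)) ^ (L ^ 2)) *
    (∏ n, modifiedWeight (L ^ 2) (m + M') c w (y n)) *
    hyperpfaffian (gramVector (L ^ 2) (modifiedWeight (L ^ 2) (m + M') c w) μ L p y)

end Gram

end

/-!
The statement says that, for `β = L²`, the Vandermonde product to the power `β` linearizes. Let
`V(x) = ∑_t Wr(p_t; x) e_t`, an `L`-vector; it is the wedge product of the `L` vectors of Hasse
derivatives `(D^ℓ p_n(x))_n`. Hence `V(x_1) ∧ ⋯ ∧ V(x_{M'})` has as its volume coefficient the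
determinant of a confluent Vandermonde matrix, in which every node is repeated `L` times, and this
determinant is `∏_{j<k} (x_k - x_j)^(L²)`. Integrating the product one variable at a time (de
Bruijn's identity) gives the `M'`-th wedge power of `∫ V`, that is, a hyperpfaffian. The phase `c`
reduces the density, a product of powers of `|x_k - x_j|`, to this algebraic form, because `β/2`
is an integer and every `c(x_j)` occurs in `M - 1` of the pairs.

Everything converges as soon as `∫ (1 + |x|)^(β(M-1)) w dμ` does. To see that it does, fix `M`
distinct points such that the density is integrable along each coordinate line through them, as
Fubini allows: every `x` stays away from all but one of these points, so `(1 + |x|)^(β(M-1))` is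
bounded by a constant times the sum, over the points left out, of the products of the `β`-th powers
of the distances to the remaining ones.

The law of the particles is exchangeable, so `E[N_{B_1} ⋯ N_{B_m}]` for disjoint `B_i` is
`M!/(M-m)!` times the probability that the `i`-th particle lies in `B_i` for all `i ≤ m`.
Conversely these expectations determine the correlation function almost everywhere on every product
of disjoint sets, and countably many such products cover the configurations of distinct points.
-/

noncomputable section

section ConfluentVandermonde

open Polynomial

variable {R : Type*} [CommRing R] {L n : ℕ}

/-- The block, of length `L`, in which an index `i < L * n` lies. -/
def blockIndex (i : Fin (L * n)) : Fin n :=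
  (i.cast (Nat.mul_comm L n)).divNat

/-- The position of an index `i < L * n` inside its block of length `L`. -/
def blockOffset (i : Fin (L * n)) : Fin L :=
  (i.cast (Nat.mul_comm L n)).modNat

theorem coe_blockIndex (i : Fin (L * n)) : (blockIndex i : ℕ) = i / L := rfl

theorem coe_blockOffset (i : Fin (L * n)) : (blockOffset i : ℕ) = i % L := rfl

theorem prod_blockIndex {A : Type*} [CommMonoid A] (f : Fin n → A) :
    ∏ i : Fin (L * n), f (blockIndex i) = ∏ k, f k ^ L := by
  calc ∏ i : Fin (L * n), f (blockIndex i) = ∏ a : Fin n × Fin L, f a.1 :=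
        ((finCongr (Nat.mul_comm L n)).trans finProdFinEquiv.symm).prod_comp fun a => f a.1
    _ = ∏ k, f k ^ L := by
        simp only [Fintype.prod_prod_type, Finset.prod_const, Finset.card_univ, Fintype.card_fin]

theorem blockIndex_lt_or_blockOffset_lt {i j : Fin (L * n)} (h : i < j) :
    blockIndex i < blockIndex j ∨
      blockIndex i = blockIndex j ∧ blockOffset i < blockOffset j := by
  simp only [Fin.lt_def, Fin.ext_iff, coe_blockIndex, coe_blockOffset] at h ⊢
  have hi := Nat.div_add_mod (i : ℕ) L
  have hj := Nat.div_add_mod (j : ℕ) L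
  rcases (Nat.div_le_div_right (c := L) h.le).lt_or_eq with hlt | heq
  · exact .inl hlt
  · rw [heq] at hi
    exact .inr ⟨heq, by omega⟩

/-- The confluent Vandermonde matrix `[D^ℓ p_j (x_k)]` with `L` rows per node, where `D^ℓ` is the
Hasse derivative and the row `i` stands for the pair `(k, ℓ) = (i / L, i % L)`. -/
def confluentMatrix (p : Fin (L * n) → R[X]) (x : Fin n → R) :
    Matrix (Fin (L * n)) (Fin (L * n)) R :=
  Matrix.of fun i j => (hasseDeriv (blockOffset i) (p j)).eval (x (blockIndex i))

theorem confluentMatrix_eq_mul {p : Fin (L * n) → R[X]} (hdeg : ∀ j, (p j).natDegree ≤ j)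
    (x : Fin n → R) :
    confluentMatrix p x = confluentMatrix (fun j => X ^ (j : ℕ)) x *
      Matrix.of (fun i j : Fin (L * n) => (p j).coeff i) := by
  ext i j
  rw [Matrix.mul_apply]
  simp only [confluentMatrix, Matrix.of_apply]
  conv_lhs => rw [(p j).as_sum_range' (L * n) ((hdeg j).trans_lt j.2)]
  rw [map_sum, eval_finsetSum, Finset.sum_range]
  refine Finset.sum_congr rfl fun k _ => ?_
  rw [← C_mul_X_pow_eq_monomial, ← smul_eq_C_mul, map_smul, eval_smul, smul_eq_mul, mul_comm]

theorem det_confluentMatrix_eq_det_X_pow {p : Fin (L * n) → R[X]}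
    (hdeg : ∀ j, (p j).natDegree = j) (hmonic : ∀ j, (p j).Monic) (x : Fin n → R) :
    (confluentMatrix p x).det =
      (confluentMatrix (fun j : Fin (L * n) => (X : R[X]) ^ (j : ℕ)) x).det := by
  rw [confluentMatrix_eq_mul (fun j => (hdeg j).le), Matrix.det_mul,
    Matrix.det_matrixOfPolynomials p hdeg hmonic, mul_one]

/-- The Newton basis of Hermite interpolation at the nodes `x`, each taken `L` times. It makes the
confluent Vandermonde matrix triangular. -/
def hermiteBasis (x : Fin n → R) (i : Fin (L * n)) : R[X] :=
  (∏ j ∈ Finset.Iio (blockIndex i), (X - C (x j)) ^ L) *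
    (X - C (x (blockIndex i))) ^ (blockOffset i : ℕ)

theorem monic_hermiteBasis (x : Fin n → R) (i : Fin (L * n)) : (hermiteBasis x i).Monic :=
  (monic_prod_of_monic _ _ fun _ _ => (monic_X_sub_C _).pow _).mul ((monic_X_sub_C _).pow _)

theorem natDegree_hermiteBasis [Nontrivial R] (x : Fin n → R) (i : Fin (L * n)) :
    (hermiteBasis x i).natDegree = i := by
  have hpow : ∀ (j : Fin n) (r : ℕ), ((X - C (x j)) ^ r).natDegree = r := fun j r => by
    rw [(monic_X_sub_C _).natDegree_pow, natDegree_X_sub_C, mul_one]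
  rw [hermiteBasis, (monic_prod_of_monic _ _ fun _ _ => (monic_X_sub_C _).pow _).natDegree_mul
      ((monic_X_sub_C _).pow _),
    natDegree_prod_of_monic _ _ fun _ _ => (monic_X_sub_C _).pow _]
  simp only [hpow, Finset.sum_const, Fin.card_Iio, smul_eq_mul]
  exact Nat.div_add_mod' _ _

theorem eval_hasseDeriv_eq_zero_of_dvd {q : R[X]} {a : R} {r ℓ : ℕ} (h : (X - C a) ^ r ∣ q)
    (hℓ : ℓ < r) : (hasseDeriv ℓ q).eval a = 0 := by
  obtain ⟨s, rfl⟩ := h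
  rw [← taylor_coeff, taylor_mul, taylor_pow]
  simp only [map_sub, taylor_X, taylor_C, add_sub_cancel_right]
  rw [coeff_X_pow_mul', if_neg hℓ.not_ge]

theorem eval_hasseDeriv_mul_X_sub_C_pow (q : R[X]) (a : R) (r : ℕ) :
    (hasseDeriv r (q * (X - C a) ^ r)).eval a = q.eval a := by
  rw [← taylor_coeff, taylor_mul, taylor_pow]
  simp only [map_sub, taylor_X, taylor_C, add_sub_cancel_right]
  rw [coeff_mul_X_pow', if_pos le_rfl, Nat.sub_self, taylor_coeff_zero]

theorem isLowerTriangular_confluentMatrix_hermiteBasis (x : Fin n → R) :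
    (confluentMatrix (hermiteBasis (L := L) x) x).IsLowerTriangular := by
  intro i j hij
  rw [confluentMatrix, Matrix.of_apply]
  rcases blockIndex_lt_or_blockOffset_lt (show i < j from hij) with hblock | ⟨hblock, hoffset⟩
  · exact eval_hasseDeriv_eq_zero_of_dvd (((Finset.dvd_prod_of_mem
      (fun j => (X - C (x j)) ^ L) (Finset.mem_Iio.2 hblock))).mul_right _) (blockOffset i).2
  · rw [hblock]
    exact eval_hasseDeriv_eq_zero_of_dvd (dvd_mul_left _ _) hoffset

theorem det_confluentMatrix_hermiteBasis (x : Fin n → R) :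
    (confluentMatrix (hermiteBasis (L := L) x) x).det =
      ∏ j, ∏ k ∈ Finset.Ioi j, (x k - x j) ^ (L ^ 2) := by
  have hdiag : ∀ i : Fin (L * n), confluentMatrix (hermiteBasis (L := L) x) x i i =
      ∏ j ∈ Finset.Iio (blockIndex i), (x (blockIndex i) - x j) ^ L := fun i => by
    rw [confluentMatrix, Matrix.of_apply, hermiteBasis, eval_hasseDeriv_mul_X_sub_C_pow, eval_prod]
    simp only [eval_pow, eval_sub, eval_X, eval_C]
  rw [Matrix.det_of_isLowerTriangular _ (isLowerTriangular_confluentMatrix_hermiteBasis x),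
    Fintype.prod_congr _ _ hdiag,
    prod_blockIndex fun k : Fin n => ∏ j ∈ Finset.Iio k, (x k - x j) ^ L]
  simp only [← Finset.prod_pow, ← pow_mul, ← sq]
  exact Finset.prod_comm' (by simp)

theorem det_confluentMatrix {p : Fin (L * n) → R[X]} (hdeg : ∀ j, (p j).natDegree = j)
    (hmonic : ∀ j, (p j).Monic) (x : Fin n → R) :
    (confluentMatrix p x).det = ∏ j, ∏ k ∈ Finset.Ioi j, (x k - x j) ^ (L ^ 2) := by
  nontriviality R
  rw [det_confluentMatrix_eq_det_X_pow hdeg hmonic,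
    ← det_confluentMatrix_eq_det_X_pow (natDegree_hermiteBasis x) (monic_hermiteBasis x),
    det_confluentMatrix_hermiteBasis]

end ConfluentVandermonde

section ExteriorAlgebra

open Module

theorem basis_exteriorAlgebra_univ {R V : Type*} [CommRing R] [AddCommGroup V] [Module R V] {N : ℕ}
    (b : Basis (Fin N) R V) :
    b.ExteriorAlgebra Finset.univ = ExteriorAlgebra.ιMulti R N b := by
  have hid : ⇑(Set.powersetCard.ofFinEmbEquiv.symm
      (Set.powersetCard.ofCard (s := (Finset.univ : Finset (Fin N))) (n := N) (by simp))) = id :=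
    (Finset.orderEmbOfFin_unique (s := Finset.univ) (by simp) (f := id) (by simp)
      strictMono_id).symm
  rw [ExteriorAlgebra.basis_apply_ofCard b (n := N) (by simp), ExteriorAlgebra.ιMulti_family, hid,
    Function.comp_id]

theorem ιMulti_eq_sum_det_smul {R V I : Type*} [CommRing R] [AddCommGroup V] [Module R V]
    [LinearOrder I] [Fintype I] (b : Basis I R V) {L : ℕ} (v : Fin L → V) :
    exteriorPower.ιMulti R L v = ∑ t : Set.powersetCard I L,
      (Matrix.of fun i j => b.repr (v i) (Set.powersetCard.ofFinEmbEquiv.symm t j)).det •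
        exteriorPower.ιMulti_family R L b t := by
  conv_lhs => rw [← (b.exteriorPower L).sum_repr (exteriorPower.ιMulti R L v)]
  refine Finset.sum_congr rfl fun t _ => ?_
  rw [exteriorPower.basis_repr_apply, exteriorPower.ιMultiDual_apply_ιMulti,
    exteriorPower.basis_apply]
  rfl

theorem prod_ofFn_ιMulti {R V : Type*} [CommRing R] [AddCommGroup V] [Module R V] {L n : ℕ}
    (v : Fin n → Fin L → V) :
    (List.ofFn fun k => ExteriorAlgebra.ιMulti R L (v k)).prod =
      ExteriorAlgebra.ιMulti R (L * n) fun i => v (blockIndex i) (blockOffset i) := by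
  simp only [ExteriorAlgebra.ιMulti_apply]
  rw [List.ofFn_mul', List.prod_flatten, List.map_ofFn]
  congr 2
  funext k
  simp only [Function.comp_apply]
  congr 2
  funext l
  congr 2
  · ext; simp [coe_blockIndex, Nat.mul_add_div l.pos, Nat.div_eq_of_lt l.2]
  · ext; simp [coe_blockOffset, Nat.mod_eq_of_lt l.2]

variable {K : Type*} [Field K]

theorem volumeCoeff_smul {N : ℕ} (a : K) (α : ExteriorAlgebra K (Fin N → K)) :
    volumeCoeff (a • α) = a * volumeCoeff α := by
  simp only [volumeCoeff, map_smul, Finsupp.smul_apply, smul_eq_mul]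

theorem volumeCoeff_sum {N : ℕ} {ι : Type*} (s : Finset ι)
    (α : ι → ExteriorAlgebra K (Fin N → K)) :
    volumeCoeff (∑ i ∈ s, α i) = ∑ i ∈ s, volumeCoeff (α i) := by
  simp only [volumeCoeff, map_sum, Finsupp.finsetSum_apply]

theorem volumeCoeff_ιMulti {N : ℕ} (v : Fin N → Fin N → K) :
    volumeCoeff (ExteriorAlgebra.ιMulti K N v) = (Matrix.of v).det := by
  let b := Pi.basisFun K (Fin N)
  let ψ : (Fin N → K) [⋀^Fin N]→ₗ[K] K :=
    (b.ExteriorAlgebra.coord Finset.univ).compAlternatingMap (ExteriorAlgebra.ιMulti K N)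
  have hψ : ψ b = 1 := by
    change b.ExteriorAlgebra.repr (ExteriorAlgebra.ιMulti K N b) Finset.univ = 1
    rw [← basis_exteriorAlgebra_univ, Basis.repr_self, Finsupp.single_eq_same]
  calc volumeCoeff (ExteriorAlgebra.ιMulti K N v) = ψ v := rfl
    _ = b.det v := by rw [ψ.eq_smul_basis_det b, hψ, one_smul]
    _ = (Matrix.of v).det := by rw [Basis.det_apply, ← Matrix.det_transpose]; rfl

theorem volumeCoeff_prod_ofFn_sum {ι : Type*} [Fintype ι] {N n : ℕ}
    (a : Fin n → ι → K) (e : ι → ExteriorAlgebra K (Fin N → K)) :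
    volumeCoeff (List.ofFn fun k => ∑ t, a k t • e t).prod =
      ∑ r : Fin n → ι, (∏ k, a k (r k)) * volumeCoeff (List.ofFn fun k => e (r k)).prod := by
  classical
  have hexpand := (MultilinearMap.mkPiAlgebraFin K n (ExteriorAlgebra K (Fin N → K))).map_sum
    fun k t => a k t • e t
  simp only [MultilinearMap.map_smul_univ, MultilinearMap.mkPiAlgebraFin_apply] at hexpand
  simp only [hexpand, volumeCoeff_sum, volumeCoeff_smul]

theorem sum_wronskian_smul {N L : ℕ} (p : Fin N → Polynomial K) (x : K) :
    ∑ t : Set.powersetCard (Fin N) L,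
      wronskian p t x • exteriorPower.ιMulti_family K L (Pi.basisFun K (Fin N)) t =
    exteriorPower.ιMulti K L fun ℓ n => (Polynomial.hasseDeriv (ℓ : ℕ) (p n)).eval x := by
  rw [ιMulti_eq_sum_det_smul (Pi.basisFun K (Fin N))]
  rfl

theorem volumeCoeff_prod_sum_wronskian {L n : ℕ} {p : Fin (L * n) → Polynomial K}
    (hp : IsCompleteMonicFamily p) (x : Fin n → K) :
    volumeCoeff (List.ofFn fun k => ∑ t : Set.powersetCard (Fin (L * n)) L, wronskian p t (x k) •
      (exteriorPower.ιMulti_family K L (Pi.basisFun K (Fin (L * n))) t :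
        ExteriorAlgebra K (Fin (L * n) → K))).prod =
    ∏ j, ∏ k ∈ Finset.Ioi j, (x k - x j) ^ (L ^ 2) := by
  have hdecomposable : ∀ z, ∑ t : Set.powersetCard (Fin (L * n)) L, wronskian p t z •
      (exteriorPower.ιMulti_family K L (Pi.basisFun K (Fin (L * n))) t :
        ExteriorAlgebra K (Fin (L * n) → K)) = ExteriorAlgebra.ιMulti K L
          fun ℓ j => (Polynomial.hasseDeriv (ℓ : ℕ) (p j)).eval z := fun z => by
    simpa using congrArg Subtype.val (sum_wronskian_smul (L := L) p z)
  simp only [hdecomposable]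
  rw [prod_ofFn_ιMulti, volumeCoeff_ιMulti,
    ← det_confluentMatrix (fun j => (hp j).2) fun j => (hp j).1]
  rfl

end ExteriorAlgebra

section DeBruijn

theorem hyperpfaffian_sum_smul {K : Type*} [Field K] {L n : ℕ} {ι : Type*} [Fintype ι]
    (a : ι → K) (e : ι → ⋀[K]^L (Fin (L * n) → K)) :
    hyperpfaffian (∑ t, a t • e t) = (n ! : K)⁻¹ * ∑ r : Fin n → ι, (∏ k, a (r k)) *
      volumeCoeff (List.ofFn fun k => (e (r k) : ExteriorAlgebra K (Fin (L * n) → K))).prod := by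
  have hpow := volumeCoeff_prod_ofFn_sum (n := n) (fun _ => a)
    fun t => (e t : ExteriorAlgebra K (Fin (L * n) → K))
  rw [List.ofFn_const, List.prod_replicate] at hpow
  rw [hyperpfaffian, volumeCoeff_smul, ← hpow, AddSubmonoidClass.coe_finsetSum]
  rfl

variable {𝕜 : Type*} [RCLike 𝕜] {X : Type*} [MeasurableSpace X] (μ : Measure X) [SigmaFinite μ]

theorem integral_pi_prod_sum {ι : Type*} [Fintype ι] {n : ℕ} {h : ι → X → 𝕜}
    (hint : ∀ t, Integrable (h t) μ) (b : (Fin n → ι) → 𝕜) :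
    ∫ x : Fin n → X, ∑ r : Fin n → ι, (∏ k, h (r k) (x k)) * b r ∂(Measure.pi fun _ => μ) =
      ∑ r : Fin n → ι, (∏ k, ∫ x, h (r k) x ∂μ) * b r := by
  rw [integral_finsetSum _ fun r _ =>
    (Integrable.fintype_prod (f := fun k => h (r k)) fun k => hint (r k)).mul_const _]
  refine Finset.sum_congr rfl fun r _ => ?_
  rw [integral_mul_const, integral_fintype_prod_eq_prod fun k => h (r k)]

theorem hyperpfaffian_sum_integral_wronskian {L n : ℕ} {p : Fin (L * n) → Polynomial 𝕜}
    (hp : IsCompleteMonicFamily p) {ξ g : X → 𝕜}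
    (hint : ∀ t : Set.powersetCard (Fin (L * n)) L,
      Integrable (fun x => g x * wronskian p t (ξ x)) μ) :
    hyperpfaffian (∑ t : Set.powersetCard (Fin (L * n)) L,
      (∫ x, g x * wronskian p t (ξ x) ∂μ) •
        exteriorPower.ιMulti_family 𝕜 L (Pi.basisFun 𝕜 (Fin (L * n))) t) =
    (n ! : 𝕜)⁻¹ * ∫ x : Fin n → X, (∏ k, g (x k)) *
      ∏ j, ∏ k ∈ Finset.Ioi j, (ξ (x k) - ξ (x j)) ^ (L ^ 2) ∂(Measure.pi fun _ => μ) := by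
  rw [hyperpfaffian_sum_smul, ← integral_pi_prod_sum μ hint]
  congr 2 with x
  rw [← volumeCoeff_prod_sum_wronskian hp fun k => ξ (x k), volumeCoeff_prod_ofFn_sum,
    Finset.mul_sum]
  simp only [Finset.prod_mul_distrib, mul_assoc]

end DeBruijn

section WronskianGrowth

open Polynomial

theorem natDegree_det_hasseDeriv_le {R : Type*} [CommRing R] {L d : ℕ} {q : Fin L → R[X]}
    (hq : ∀ k, (q k).natDegree ≤ d + k) :
    (Matrix.of fun ℓ k : Fin L => hasseDeriv (ℓ : ℕ) (q k)).det.natDegree ≤ L * d := by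
  rw [Matrix.det_apply]
  refine natDegree_sum_le_of_forall_le _ _ fun σ _ => (natDegree_smul_le _ _).trans ?_
  simp only [Matrix.of_apply]
  by_cases hσ : ∃ k, (q k).natDegree < σ k
  · obtain ⟨k, hk⟩ := hσ
    rw [Finset.prod_eq_zero (Finset.mem_univ k) (hasseDeriv_eq_zero_of_lt_natDegree _ _ hk),
      natDegree_zero]
    exact Nat.zero_le _
  · push Not at hσ
    have hdrop : ∀ k, (hasseDeriv (σ k : ℕ) (q k)).natDegree + σ k ≤ d + k := fun k =>
      (Nat.le_sub_iff_add_le (hσ k)).1 (natDegree_hasseDeriv_le _ _) |>.trans (hq k)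
    have hsum := Finset.sum_le_sum fun k (_ : k ∈ Finset.univ) => hdrop k
    rw [Finset.sum_add_distrib, Finset.sum_add_distrib,
      Equiv.sum_comp σ fun k : Fin L => (k : ℕ), add_le_add_iff_right] at hsum
    simpa using (natDegree_prod_le _ _).trans hsum

theorem orderEmbedding_fin_apply_le {L N : ℕ} (s : Fin L ↪o Fin N) (k : Fin L) :
    (s k : ℕ) ≤ (N - L) + k := by
  have hcard := Finset.card_le_card_of_injOn (s := Finset.Ioi k) (t := Finset.Ioi (s k)) s
    (fun j hj => by simpa using hj) s.injective.injOn
  rw [Fin.card_Ioi, Fin.card_Ioi] at hcard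
  have := k.2
  have := (s k).2
  omega

variable {K : Type*} [Field K] {N L : ℕ}

/-- The Wronskian of the subfamily of `p` indexed by `t`, as a polynomial. -/
def wronskianPolynomial (p : Fin N → K[X]) (t : Set.powersetCard (Fin N) L) : K[X] :=
  (Matrix.of fun ℓ k : Fin L =>
    hasseDeriv (ℓ : ℕ) (p (Set.powersetCard.ofFinEmbEquiv.symm t k))).det

theorem eval_wronskianPolynomial (p : Fin N → K[X]) (t : Set.powersetCard (Fin N) L) (x : K) :
    (wronskianPolynomial p t).eval x = _root_.wronskian p t x := by
  rw [wronskianPolynomial, ← coe_evalRingHom, RingHom.map_det]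
  rfl

theorem natDegree_wronskianPolynomial_le {p : Fin N → K[X]} (hp : ∀ n, (p n).natDegree ≤ n)
    (t : Set.powersetCard (Fin N) L) : (wronskianPolynomial p t).natDegree ≤ L * (N - L) :=
  natDegree_det_hasseDeriv_le fun k => (hp _).trans (orderEmbedding_fin_apply_le _ k)

theorem exists_norm_eval_le {R : Type*} [SeminormedRing R] [NormOneClass R] {q : R[X]} {d : ℕ}
    (hq : q.natDegree ≤ d) : ∃ C : ℝ, 0 ≤ C ∧ ∀ x : R, ‖q.eval x‖ ≤ C * (1 + ‖x‖) ^ d := by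
  refine ⟨∑ i ∈ Finset.range (q.natDegree + 1), ‖q.coeff i‖, by positivity, fun x => ?_⟩
  rw [eval_eq_sum_range, Finset.sum_mul]
  refine (norm_sum_le _ _).trans (Finset.sum_le_sum fun i hi => (norm_mul_le _ _).trans ?_)
  have hid : i ≤ d := (Finset.mem_range_succ_iff.1 hi).trans hq
  gcongr
  calc ‖x ^ i‖ ≤ ‖x‖ ^ i := norm_pow_le x i
    _ ≤ (1 + ‖x‖) ^ i := by gcongr; linarith
    _ ≤ (1 + ‖x‖) ^ d := pow_le_pow_right₀ (by linarith [norm_nonneg x]) hid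

end WronskianGrowth

section PairProducts

theorem prod_Ioi_mul_eq_prod_pow {A : Type*} [CommMonoid A] {n : ℕ} (a : Fin n → A) :
    ∏ j, ∏ k ∈ Finset.Ioi j, (a j * a k) = ∏ j, a j ^ (n - 1) := by
  have hswap : ∏ j, ∏ k ∈ Finset.Ioi j, a k = ∏ k, ∏ _j ∈ Finset.Iio k, a k :=
    Finset.prod_comm' (by simp)
  simp only [Finset.prod_mul_distrib]
  rw [hswap, ← Finset.prod_mul_distrib]
  refine Finset.prod_congr rfl fun j _ => ?_
  rw [Finset.prod_const, Finset.prod_const, Fin.card_Ioi, Fin.card_Iio, ← pow_add]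
  congr 1
  omega

theorem prod_Ioi_append {A α : Type*} [CommMonoid A] {m n : ℕ} (F : α → α → A) (y : Fin m → α)
    (x : Fin n → α) :
    ∏ j, ∏ k ∈ Finset.Ioi j, F (Fin.append y x j) (Fin.append y x k) =
      (∏ j, ∏ k ∈ Finset.Ioi j, F (y j) (y k)) * (∏ l, ∏ j, F (y j) (x l)) *
        ∏ j, ∏ k ∈ Finset.Ioi j, F (x j) (x k) := by
  have hIoi : ∀ {n : ℕ} (j : Fin n) (G : Fin n → A),
      ∏ k ∈ Finset.Ioi j, G k = ∏ k, if j < k then G k else 1 := fun j G => by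
    rw [← Finset.prod_filter, Finset.filter_lt_eq_Ioi]
  have hlt : ∀ (i : Fin m) (k : Fin n), Fin.castAdd n i < Fin.natAdd m k := fun i k => by
    simp only [Fin.lt_def, Fin.val_castAdd, Fin.val_natAdd]; omega
  simp only [hIoi, Fin.prod_univ_add, Fin.append_left, Fin.append_right, hlt, (hlt _ _).not_gt,
    (Fin.strictMono_castAdd n).lt_iff_lt, Fin.natAdd_lt_natAdd_iff, if_true, if_false,
    Finset.prod_mul_distrib, Finset.prod_const_one]
  rw [Finset.prod_comm (f := fun i k => F (y i) (x k)), mul_one, mul_assoc]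

end PairProducts

section Nodes

variable {E : Type*} [NormedAddCommGroup E]

theorem norm_sub_le_one_add_mul (a b : E) : ‖a - b‖ ≤ (1 + ‖a‖) * (1 + ‖b‖) := by
  have := norm_sub_le a b
  nlinarith [norm_nonneg a, norm_nonneg b]

theorem one_add_norm_le_mul_norm_sub_of_ne {a b t : E} (hab : a ≠ b) (ht : ‖t - a‖ ≤ ‖t - b‖) :
    1 + ‖t‖ ≤ (1 + (1 + ‖b‖) * (2 / ‖b - a‖)) * ‖t - b‖ := by
  have hpos : 0 < ‖b - a‖ := norm_pos_iff.2 (sub_ne_zero.2 hab.symm)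
  have hdist : ‖b - a‖ ≤ ‖t - a‖ + ‖t - b‖ := by simpa using norm_sub_le (t - a) (t - b)
  have hone : 1 ≤ 2 / ‖b - a‖ * ‖t - b‖ := by
    rw [div_mul_eq_mul_div, le_div_iff₀ hpos]
    linarith
  calc 1 + ‖t‖ ≤ ‖t - b‖ + (1 + ‖b‖) * 1 := by linarith [norm_le_norm_sub_add t b]
    _ ≤ ‖t - b‖ + (1 + ‖b‖) * (2 / ‖b - a‖ * ‖t - b‖) := by gcongr
    _ = (1 + (1 + ‖b‖) * (2 / ‖b - a‖)) * ‖t - b‖ := by ring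

theorem exists_one_add_norm_le_mul_norm_sub {ι : Type*} [Finite ι] [Nonempty ι] {x : ι → E}
    (hx : Function.Injective x) :
    ∃ K : ℝ, 0 ≤ K ∧ ∀ t, ∃ i, ∀ j ≠ i, 1 + ‖t‖ ≤ K * ‖t - x j‖ := by
  obtain ⟨K, hK⟩ := Finite.exists_le fun p : ι × ι =>
    1 + (1 + ‖x p.2‖) * (2 / ‖x p.2 - x p.1‖)
  refine ⟨K, le_trans (by positivity) (hK (Classical.arbitrary _)), fun t => ?_⟩
  obtain ⟨i, hi⟩ := Finite.exists_min fun i => ‖t - x i‖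
  exact ⟨i, fun j hj => (one_add_norm_le_mul_norm_sub_of_ne (hx.ne hj.symm) (hi j)).trans
    (mul_le_mul_of_nonneg_right (hK (i, j)) (norm_nonneg _))⟩

theorem exists_one_add_norm_pow_le_mul_sum {n : ℕ} (β : ℕ) {x : Fin (n + 1) → E}
    (hx : Function.Injective x) :
    ∃ C : ℝ, ∀ t : E, (1 + ‖t‖) ^ (β * n) ≤
      C * ∑ i : Fin (n + 1), ∏ j : Fin n, ‖t - x (i.succAbove j)‖ ^ β := by
  obtain ⟨K, hK, hnodes⟩ := exists_one_add_norm_le_mul_norm_sub hx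
  refine ⟨K ^ (β * n), fun t => ?_⟩
  obtain ⟨i, hi⟩ := hnodes t
  calc (1 + ‖t‖) ^ (β * n) = ∏ _j : Fin n, (1 + ‖t‖) ^ β := by
        rw [Finset.prod_const, Finset.card_univ, Fintype.card_fin, pow_mul]
    _ ≤ ∏ j : Fin n, (K * ‖t - x (i.succAbove j)‖) ^ β := by
        gcongr with j
        exact hi _ (Fin.succAbove_ne i j)
    _ = K ^ (β * n) * ∏ j : Fin n, ‖t - x (i.succAbove j)‖ ^ β := by
        simp only [mul_pow, Finset.prod_mul_distrib, Finset.prod_const, Finset.card_univ,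
          Fintype.card_fin, pow_mul]
    _ ≤ _ := by
        gcongr
        exact Finset.single_le_sum
          (f := fun i : Fin (n + 1) => ∏ j : Fin n, ‖t - x (i.succAbove j)‖ ^ β)
          (fun _ _ => by positivity) (Finset.mem_univ i)

end Nodes

section BetaWeight

variable {𝕜 : Type*} [RCLike 𝕜] {W : Set 𝕜} {β : ℕ} {w : W → ℝ}

theorem betaWeight_eq_norm_det (β : ℕ) (w : W → ℝ) {M : ℕ} (x : Fin M → W) :
    betaWeight β w x =
      ‖(Matrix.vandermonde fun i => (x i : 𝕜)).det‖ ^ β * ∏ l, w (x l) := by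
  rw [betaWeight, Matrix.det_vandermonde]
  simp only [norm_prod, Finset.prod_pow]

theorem betaWeight_comp_perm (β : ℕ) (w : W → ℝ) {M : ℕ} (x : Fin M → W)
    (σ : Equiv.Perm (Fin M)) : betaWeight β w (x ∘ σ) = betaWeight β w x := by
  have hrows : (Matrix.vandermonde fun i => ((x ∘ σ) i : 𝕜)) =
      (Matrix.vandermonde fun i => (x i : 𝕜)).submatrix σ id := rfl
  rw [betaWeight_eq_norm_det, betaWeight_eq_norm_det, hrows, Matrix.det_permute]
  congr 1
  · rcases Int.units_eq_one_or (Equiv.Perm.sign σ) with h | h <;> simp [h]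
  · exact Equiv.prod_comp σ fun l => w (x l)

theorem betaWeight_ne_zero_iff (hβ : β ≠ 0) {M : ℕ} (x : Fin M → W) :
    betaWeight β w x ≠ 0 ↔ Function.Injective x ∧ ∀ l, w (x l) ≠ 0 := by
  rw [betaWeight_eq_norm_det, mul_ne_zero_iff, pow_ne_zero_iff hβ, norm_ne_zero_iff,
    Matrix.det_vandermonde_ne_zero_iff, Finset.prod_ne_zero_iff]
  simp only [Finset.mem_univ, true_imp_iff]
  exact and_congr_left fun _ => Subtype.val_injective.of_comp_iff x

theorem betaWeight_nonneg (β : ℕ) (hw0 : ∀ x, 0 ≤ w x) {M : ℕ} (x : Fin M → W) :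
    0 ≤ betaWeight β w x :=
  mul_nonneg (by positivity) (Finset.prod_nonneg fun _ _ => hw0 _)

theorem betaWeight_cons (β : ℕ) (w : W → ℝ) {n : ℕ} (a : W) (z : Fin n → W) :
    betaWeight β w (Fin.cons a z : Fin (n + 1) → W) =
      (∏ j, ‖(a : 𝕜) - z j‖ ^ β) * w a * betaWeight β w z := by
  simp only [betaWeight, Fin.prod_univ_succ, Fin.prod_Ioi_zero, Fin.prod_Ioi_succ, Fin.cons_zero,
    Fin.cons_succ, norm_sub_rev (z _ : 𝕜) (a : 𝕜)]
  ring

theorem betaWeight_le_prod (β : ℕ) (hw0 : ∀ x, 0 ≤ w x) {M : ℕ} (x : Fin M → W) :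
    betaWeight β w x ≤ ∏ l, ((1 + ‖(x l : 𝕜)‖) ^ (β * (M - 1)) * w (x l)) := by
  rw [Finset.prod_mul_distrib, betaWeight]
  refine mul_le_mul_of_nonneg_right ?_ (Finset.prod_nonneg fun _ _ => hw0 _)
  simp only [pow_mul]
  rw [← prod_Ioi_mul_eq_prod_pow fun l => (1 + ‖(x l : 𝕜)‖) ^ β]
  gcongr with j _ k
  rw [← mul_pow, mul_comm]
  gcongr
  exact norm_sub_le_one_add_mul _ _

variable [MeasurableSpace W]

theorem measurable_betaWeight (hW : Measurable fun x : W => (x : 𝕜)) (β : ℕ) (hw : Measurable w)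
    (M : ℕ) : Measurable fun x : Fin M → W => betaWeight β w x := by
  have hcoord : ∀ i : Fin M, Measurable fun x : Fin M → W => (x i : 𝕜) := fun i =>
    hW.comp (measurable_pi_apply i)
  exact (Finset.measurable_prod _ fun j _ => Finset.measurable_prod _ fun k _ =>
      ((hcoord k).sub (hcoord j)).norm.pow_const β).mul
    (Finset.measurable_prod _ fun l _ => hw.comp (measurable_pi_apply l))

variable {μ : Measure W} [SigmaFinite μ] {n : ℕ}

theorem ae_integrable_prod_norm_sub_mul_weight
    (hint : Integrable (fun x : Fin (n + 1) → W => betaWeight β w x) (Measure.pi fun _ => μ)) :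
    ∀ᵐ z ∂(Measure.pi fun _ : Fin n => μ), betaWeight β w z ≠ 0 →
      Integrable (fun a : W => (∏ j, ‖(a : 𝕜) - z j‖ ^ β) * w a) μ := by
  have hprod : Integrable (fun q : W × (Fin n → W) => betaWeight β w (Fin.cons q.1 q.2 :
      Fin (n + 1) → W)) (μ.prod (Measure.pi fun _ => μ)) :=
    (((measurePreserving_piFinSuccAbove (fun _ : Fin (n + 1) => μ) 0).symm.integrable_comp_emb
      (MeasurableEquiv.measurableEmbedding _)).2 hint).congr
      (.of_forall fun q => congrArg (betaWeight β w) (Fin.insertNth_zero' q.1 q.2))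
  filter_upwards [hprod.prod_left_ae] with z hz hne
  refine (hz.mul_const (betaWeight β w z)⁻¹).congr (.of_forall fun a => ?_)
  simp only [betaWeight_cons]
  rw [mul_assoc, mul_inv_cancel₀ hne, mul_one]

theorem exists_injective_integrable_prod_norm_sub_mul_weight (hβ : β ≠ 0)
    (hint : Integrable (fun x : Fin (n + 1) → W => betaWeight β w x) (Measure.pi fun _ => μ))
    (hne : ∃ᵐ x ∂(Measure.pi fun _ : Fin (n + 1) => μ), betaWeight β w x ≠ 0) :
    ∃ x : Fin (n + 1) → W, Function.Injective x ∧ ∀ i : Fin (n + 1),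
      Integrable (fun a : W => (∏ j : Fin n, ‖(a : 𝕜) - x (i.succAbove j)‖ ^ β) * w a) μ := by
  have hslices : ∀ᵐ x ∂(Measure.pi fun _ : Fin (n + 1) => μ), ∀ i : Fin (n + 1),
      betaWeight β w (fun j => x (i.succAbove j)) ≠ 0 →
      Integrable (fun a : W => (∏ j, ‖(a : 𝕜) - x (i.succAbove j)‖ ^ β) * w a) μ :=
    ae_all_iff.2 fun i => (Measure.quasiMeasurePreserving_snd.comp
      (measurePreserving_piFinSuccAbove (fun _ : Fin (n + 1) => μ) i).quasiMeasurePreserving).ae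
        (ae_integrable_prod_norm_sub_mul_weight hint)
  obtain ⟨x, hx0, hx⟩ := (hne.and_eventually hslices).exists
  obtain ⟨hinj, hwx⟩ := (betaWeight_ne_zero_iff hβ x).1 hx0
  exact ⟨x, hinj, fun i => hx i <| (betaWeight_ne_zero_iff hβ _).2
    ⟨hinj.comp Fin.succAbove_right_injective, fun l => hwx _⟩⟩

theorem integrable_one_add_norm_pow_mul_weight {M : ℕ} (hW : Measurable fun x : W => (x : 𝕜))
    (hβ : β ≠ 0) (hM : M ≠ 0) (hw : Measurable w)
    (hint : Integrable (fun x : Fin M → W => betaWeight β w x) (Measure.pi fun _ => μ))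
    (hne : ∃ᵐ x ∂(Measure.pi fun _ : Fin M => μ), betaWeight β w x ≠ 0) :
    Integrable (fun x : W => (1 + ‖(x : 𝕜)‖) ^ (β * (M - 1)) * w x) μ := by
  obtain ⟨n, rfl⟩ := Nat.exists_eq_succ_of_ne_zero hM
  obtain ⟨x, hinj, hx⟩ := exists_injective_integrable_prod_norm_sub_mul_weight hβ hint hne
  obtain ⟨C, hC⟩ := exists_one_add_norm_pow_le_mul_sum β (Subtype.val_injective.comp hinj)
  refine ((integrable_finsetSum Finset.univ fun i _ => (hx i).norm).const_mul C).mono'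
    (((hW.norm.const_add 1).pow_const _).mul hw).aestronglyMeasurable (.of_forall fun a => ?_)
  have hnorm : ∀ i : Fin (n + 1), ‖(∏ j : Fin n, ‖(a : 𝕜) - x (i.succAbove j)‖ ^ β) * w a‖ =
      (∏ j : Fin n, ‖(a : 𝕜) - x (i.succAbove j)‖ ^ β) * ‖w a‖ := fun i => by
    rw [norm_mul, Real.norm_of_nonneg (by positivity)]
  rw [norm_mul, Real.norm_of_nonneg (by positivity), Finset.sum_congr rfl fun i _ => hnorm i,
    ← Finset.sum_mul, ← mul_assoc]
  exact mul_le_mul_of_nonneg_right (hC a) (norm_nonneg _)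

end BetaWeight

section Exchangeable

variable {X : Type*} [MeasurableSpace X]

/-- A measure on configurations `ι → X` is exchangeable if relabelling the particles preserves it.
For such laws factorial moments only involve one marginal. -/
def IsExchangeable {ι : Type*} (P : Measure (ι → X)) : Prop :=
  ∀ τ : Equiv.Perm ι, MeasurePreserving (fun x : ι → X => x ∘ τ) P P

theorem isExchangeable_pi {ι : Type*} [Fintype ι] (μ : Measure X) [SigmaFinite μ] :
    IsExchangeable (Measure.pi fun _ : ι => μ) := fun τ =>
  measurePreserving_arrowCongr' (fun _ => μ) (fun _ => μ) τ.symm (MeasurableEquiv.refl X)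
    fun _ => .id μ

theorem IsExchangeable.withDensity {ι : Type*} {P : Measure (ι → X)} (hP : IsExchangeable P)
    {F : (ι → X) → ℝ≥0∞} (hF : Measurable F)
    (hsymm : ∀ (τ : Equiv.Perm ι) x, F (x ∘ τ) = F x) : IsExchangeable (P.withDensity F) := by
  refine fun τ => ⟨(hP τ).measurable, Measure.ext fun s hs => ?_⟩
  rw [Measure.map_apply (hP τ).measurable hs, withDensity_apply _ ((hP τ).measurable hs),
    withDensity_apply _ hs, ← (hP τ).setLIntegral_comp_preimage hs hF]
  simp only [hsymm]

variable {m M : ℕ} {B : Fin m → Set X}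

theorem measurable_comp_right {ι κ : Type*} (σ : κ → ι) :
    Measurable fun x : ι → X => x ∘ σ :=
  measurable_pi_lambda _ fun i => measurable_pi_apply (σ i)

theorem lintegral_prod_occupation_eq_sum (P : Measure (Fin M → X))
    (hB : ∀ i, MeasurableSet (B i)) :
    ∫⁻ x, ∏ i, (occupation (B i) x : ℝ≥0∞) ∂P =
      ∑ σ : Fin m → Fin M, P ((fun x => x ∘ σ) ⁻¹' Set.univ.pi B) := by
  classical
  have hmeas : ∀ σ : Fin m → Fin M,
      MeasurableSet ((fun x : Fin M → X => x ∘ σ) ⁻¹' Set.univ.pi B) := fun σ =>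
    measurable_comp_right σ (.univ_pi hB)
  have hprod : ∀ x : Fin M → X, ∏ i, (occupation (B i) x : ℝ≥0∞) =
      ∑ σ : Fin m → Fin M, ((fun x => x ∘ σ) ⁻¹' Set.univ.pi B).indicator 1 x := fun x => by
    calc ∏ i, (occupation (B i) x : ℝ≥0∞)
        = ∏ i, ∑ j, if x j ∈ B i then 1 else 0 := by simp only [occupation, Finset.sum_boole]
      _ = ∑ σ : Fin m → Fin M, ∏ i, if x (σ i) ∈ B i then 1 else 0 := by
          rw [Finset.prod_univ_sum, Fintype.piFinset_univ]
      _ = _ := by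
          simp only [Finset.prod_boole, Finset.mem_univ, true_imp_iff, Set.indicator_apply,
            Set.mem_preimage, Set.mem_univ_pi, Function.comp_apply, Pi.one_apply]
  simp only [hprod]
  rw [lintegral_finsetSum _ fun σ _ => measurable_one.indicator (hmeas σ)]
  simp only [lintegral_indicator_one (hmeas _)]

theorem IsExchangeable.measure_preimage_comp {P : Measure (Fin M → X)} (hP : IsExchangeable P)
    {S : Set (Fin m → X)} (hS : MeasurableSet S) (σ σ' : Fin m ↪ Fin M) :
    P ((fun x => x ∘ σ) ⁻¹' S) = P ((fun x => x ∘ σ') ⁻¹' S) := by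
  obtain ⟨τ, hτ⟩ := Equiv.Perm.exists_extending_pair σ' σ σ'.injective σ.injective
  have hcomp : τ ∘ σ' = σ := funext hτ
  rw [← (hP τ).measure_preimage (measurable_comp_right σ' hS).nullMeasurableSet,
    ← Set.preimage_comp]
  simp only [Function.comp_def (f := fun x => x ∘ σ'), Function.comp_assoc, hcomp]

theorem IsExchangeable.lintegral_prod_occupation {P : Measure (Fin M → X)} (hP : IsExchangeable P)
    (hB : ∀ i, MeasurableSet (B i)) (hdisj : Pairwise fun i j => Disjoint (B i) (B j))
    (σ : Fin m ↪ Fin M) :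
    ∫⁻ x, ∏ i, (occupation (B i) x : ℝ≥0∞) ∂P =
      M.descFactorial m * P ((fun x => x ∘ σ) ⁻¹' Set.univ.pi B) := by
  classical
  have hterm : ∀ σ' : Fin m → Fin M, P ((fun x => x ∘ σ') ⁻¹' Set.univ.pi B) =
      if Function.Injective σ' then P ((fun x => x ∘ σ) ⁻¹' Set.univ.pi B) else 0 := fun σ' => by
    split_ifs with hσ'
    · exact hP.measure_preimage_comp (.univ_pi hB) ⟨σ', hσ'⟩ σ
    · obtain ⟨i, j, hij, hne⟩ : ∃ i j, σ' i = σ' j ∧ i ≠ j := by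
        simpa only [Function.Injective, not_forall, exists_prop] using hσ'
      have hempty : (fun x : Fin M → X => x ∘ σ') ⁻¹' Set.univ.pi B = ∅ :=
        Set.eq_empty_of_forall_notMem fun x hx =>
          Set.disjoint_left.1 (hdisj hne) (hx i trivial)
            (congrArg (x · ∈ B j) hij ▸ hx j trivial)
      rw [hempty, measure_empty]
  have hcard : (Finset.univ.filter fun σ' : Fin m → Fin M => Function.Injective σ').card =
      M.descFactorial m := by
    rw [← Fintype.card_subtype, Fintype.card_congr (Equiv.subtypeInjectiveEquivEmbedding _ _),
      Fintype.card_embedding_eq, Fintype.card_fin, Fintype.card_fin]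
  rw [lintegral_prod_occupation_eq_sum P hB, Finset.sum_congr rfl fun σ' _ => hterm σ',
    ← Finset.sum_filter, Finset.sum_const, hcard, nsmul_eq_mul]

end Exchangeable

section MarginalOfSymmetricDensity

variable {X : Type*} [MeasurableSpace X] {m n : ℕ} (μ : Measure X) [SigmaFinite μ]

theorem measurePreserving_finAppend (m n : ℕ) :
    MeasurePreserving (fun q : (Fin m → X) × (Fin n → X) => Fin.append q.1 q.2)
      ((Measure.pi fun _ => μ).prod (Measure.pi fun _ => μ)) (Measure.pi fun _ => μ) := by
  convert (measurePreserving_piCongrLeft (fun _ => μ) finSumFinEquiv).comp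
    (measurePreserving_sumPiEquivProdPi_symm fun _ : Fin m ⊕ Fin n => μ) using 1
  have happly : ∀ (g : Fin m ⊕ Fin n → X) s,
      MeasurableEquiv.piCongrLeft (fun _ => X) finSumFinEquiv g (finSumFinEquiv s) = g s :=
    MeasurableEquiv.piCongrLeft_apply_apply (β := fun _ => X) finSumFinEquiv
  funext q i
  refine Fin.addCases (fun j => ?_) (fun j => ?_) i
  · rw [Fin.append_left, ← finSumFinEquiv_apply_left]
    exact (happly ((MeasurableEquiv.sumPiEquivProdPi fun _ => X).symm q) (.inl j)).symm
  · rw [Fin.append_right, ← finSumFinEquiv_apply_right]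
    exact (happly ((MeasurableEquiv.sumPiEquivProdPi fun _ => X).symm q) (.inr j)).symm

theorem withDensity_preimage_comp_castAdd {F : (Fin (m + n) → X) → ℝ≥0∞} (hF : Measurable F)
    {S : Set (Fin m → X)} (hS : MeasurableSet S) :
    (Measure.pi fun _ => μ).withDensity F ((fun x => x ∘ Fin.castAdd n) ⁻¹' S) =
      ∫⁻ y in S, ∫⁻ x : Fin n → X, F (Fin.append y x) ∂(Measure.pi fun _ => μ)
        ∂(Measure.pi fun _ => μ) := by
  have happend := measurePreserving_finAppend μ m n
  have hpre : (fun q : (Fin m → X) × (Fin n → X) => Fin.append q.1 q.2) ⁻¹'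
      ((fun x => x ∘ Fin.castAdd n) ⁻¹' S) = S ×ˢ Set.univ := by
    ext q
    have hq : Fin.append q.1 q.2 ∘ Fin.castAdd n = q.1 := funext (Fin.append_left q.1 q.2)
    simp only [Set.mem_preimage, hq, Set.mem_prod, Set.mem_univ, and_true]
  have hmeas := measurable_comp_right (X := X) (Fin.castAdd n) hS
  rw [withDensity_apply _ hmeas, ← happend.setLIntegral_comp_preimage hmeas hF, hpre,
    setLIntegral_prod (fun q => F (Fin.append q.1 q.2)) (hF.comp happend.measurable).aemeasurable]
  simp only [Measure.restrict_univ]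

theorem isCorrelationFunction_marginal {f : (Fin (m + n) → X) → ℝ} (hf : Measurable f)
    (hf0 : ∀ x, 0 ≤ f x) (hsymm : ∀ (τ : Equiv.Perm (Fin (m + n))) x, f (x ∘ τ) = f x)
    (hint : Integrable f (Measure.pi fun _ => μ)) :
    IsCorrelationFunction μ ((Measure.pi fun _ => μ).withDensity fun x => ENNReal.ofReal (f x)) m
      fun y => ((m + n)! : ℝ) / (n ! : ℝ) *
        ∫ x : Fin n → X, f (Fin.append y x) ∂(Measure.pi fun _ => μ) := by
  have happend := measurePreserving_finAppend μ m n
  have hF : Measurable fun x => ENNReal.ofReal (f x) := hf.ennreal_ofReal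
  have hfactorial : ((m + n)! : ℝ) / (n ! : ℝ) = ((m + n).descFactorial m : ℝ) := by
    rw [Nat.descFactorial_eq_div (Nat.le_add_right m n), Nat.add_sub_cancel_left,
      Nat.cast_div (Nat.factorial_dvd_factorial (Nat.le_add_left n m)) (by positivity)]
  have hslice : ∀ᵐ y ∂(Measure.pi fun _ => μ),
      Integrable (fun x : Fin n → X => f (Fin.append y x)) (Measure.pi fun _ => μ) :=
    (happend.integrable_comp_of_integrable hint).prod_right_ae
  refine ⟨?_, fun y => mul_nonneg (by positivity) (integral_nonneg fun x => hf0 _),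
    fun B hB hdisj => ?_⟩
  · have hmeas := (hf.comp happend.measurable).stronglyMeasurable.integral_prod_right'
      (ν := Measure.pi fun _ : Fin n => μ)
    exact hmeas.measurable.const_mul _
  rw [((isExchangeable_pi μ).withDensity hF fun τ x => by rw [hsymm]).lintegral_prod_occupation
      hB hdisj (Fin.castAddEmb n)]
  have hmarginal : Measurable fun y : Fin m → X =>
      ∫⁻ x : Fin n → X, ENNReal.ofReal (f (Fin.append y x)) ∂(Measure.pi fun _ => μ) :=
    (hF.comp happend.measurable).lintegral_prod_right'
  rw [Fin.coe_castAddEmb, withDensity_preimage_comp_castAdd μ hF (.univ_pi hB),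
    ← lintegral_const_mul _ hmarginal]
  refine lintegral_congr_ae (ae_restrict_of_ae (hslice.mono fun y hy => ?_))
  beta_reduce
  rw [hfactorial, ENNReal.ofReal_mul (Nat.cast_nonneg _), ENNReal.ofReal_natCast,
    ofReal_integral_eq_lintegral_ofReal hy (.of_forall fun x => hf0 _)]

end MarginalOfSymmetricDensity

section Phase

variable {𝕜 : Type*} [RCLike 𝕜] {W : Set 𝕜} {c : W → 𝕜}

/-- `c` is a phase on `W`: a rank-one factor by which the square of a difference of points of `W`
becomes the square of its norm. It turns powers of distances into powers of a Vandermonde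
product. -/
def IsPhase (c : W → 𝕜) : Prop :=
  ∀ x y : W, ((‖(x : 𝕜) - (y : 𝕜)‖ ^ 2 : ℝ) : 𝕜) = c x * c y * ((x : 𝕜) - (y : 𝕜)) ^ 2

theorem IsPhase.norm_mul_norm (hc : IsPhase c) {x y : W} (hxy : x ≠ y) : ‖c x‖ * ‖c y‖ = 1 := by
  have hne : ‖(x : 𝕜) - y‖ ^ 2 ≠ 0 :=
    pow_ne_zero 2 (norm_ne_zero_iff.2 (sub_ne_zero.2 (Subtype.val_injective.ne hxy)))
  have hnorm := congrArg norm (hc x y)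
  rw [norm_mul, norm_mul, norm_pow, RCLike.norm_ofReal, abs_of_nonneg (by positivity)] at hnorm
  exact mul_right_cancel₀ hne (hnorm.symm.trans (one_mul _).symm)

theorem IsPhase.exists_norm_le (hc : IsPhase c) : ∃ C : ℝ, ∀ x, ‖c x‖ ≤ C := by
  rcases isEmpty_or_nonempty W with _ | ⟨⟨y⟩⟩
  · exact ⟨0, fun x => isEmptyElim x⟩
  refine ⟨‖c y‖ + ‖c y‖⁻¹, fun x => ?_⟩
  rcases eq_or_ne x y with rfl | hxy
  · exact le_add_of_nonneg_right (by positivity)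
  · rw [eq_inv_of_mul_eq_one_left (hc.norm_mul_norm hxy)]
    exact le_add_of_nonneg_left (norm_nonneg _)

theorem IsPhase.eq_div (hc : IsPhase c) {x y : W} (hxy : x ≠ y) :
    c x = ((‖(x : 𝕜) - (y : 𝕜)‖ ^ 2 : ℝ) : 𝕜) / (c y * ((x : 𝕜) - (y : 𝕜)) ^ 2) := by
  have hsub : (x : 𝕜) - y ≠ 0 := sub_ne_zero.2 (Subtype.val_injective.ne hxy)
  have hcy : c y ≠ 0 := norm_ne_zero_iff.1 (right_ne_zero_of_mul_eq_one (hc.norm_mul_norm hxy))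
  rw [hc x y]
  field_simp

theorem IsPhase.measurable [MeasurableSpace W] (hc : IsPhase c)
    (hW : Measurable fun x : W => (x : 𝕜)) : Measurable c := by
  classical
  rcases isEmpty_or_nonempty W with _ | ⟨⟨y⟩⟩
  · exact Subsingleton.measurable
  have hy : {x : W | x = y} = Subtype.val ⁻¹' {(y : 𝕜)} := by ext x; simp [Subtype.ext_iff]
  have heq : c = fun x => if x = y then c y else
      ((‖(x : 𝕜) - (y : 𝕜)‖ ^ 2 : ℝ) : 𝕜) / (c y * ((x : 𝕜) - (y : 𝕜)) ^ 2) := by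
    funext x
    split_ifs with hxy
    · rw [hxy]
    · exact hc.eq_div hxy
  have hsub : Measurable fun x : W => (x : 𝕜) - (y : 𝕜) := hW.sub_const _
  rw [heq]
  exact Measurable.ite (hy ▸ hW (measurableSet_singleton _)) measurable_const
    ((RCLike.measurable_ofReal.comp (hsub.norm.pow_const 2)).div ((hsub.pow_const 2).const_mul _))

theorem IsPhase.betaWeight_eq_prod (hc : IsPhase c) {β : ℕ} (hβ : Even β) (w : W → ℝ) {M : ℕ}
    (x : Fin M → W) :
    ((betaWeight β w x : ℝ) : 𝕜) =
      (∏ j, ∏ k ∈ Finset.Ioi j, ((x k : 𝕜) - (x j : 𝕜)) ^ β) *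
        ∏ l, modifiedWeight β M c w (x l) := by
  have htwo : 2 * (β / 2) = β := Nat.two_mul_div_two_of_even hβ
  have hpair : ∀ j k : Fin M, ((‖(x k : 𝕜) - (x j : 𝕜)‖ ^ β : ℝ) : 𝕜) =
      ((x k : 𝕜) - (x j : 𝕜)) ^ β * (c (x j) ^ (β / 2) * c (x k) ^ (β / 2)) := fun j k => by
    calc ((‖(x k : 𝕜) - (x j : 𝕜)‖ ^ β : ℝ) : 𝕜)
        = ((‖(x k : 𝕜) - (x j : 𝕜)‖ ^ 2 : ℝ) : 𝕜) ^ (β / 2) := by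
          rw [← RCLike.ofReal_pow, ← pow_mul, htwo]
      _ = (((x k : 𝕜) - (x j : 𝕜)) ^ 2) ^ (β / 2) * (c (x j) ^ (β / 2) * c (x k) ^ (β / 2)) := by
          rw [hc, mul_pow, mul_pow]
          ring
      _ = _ := by rw [← pow_mul, htwo]
  simp only [betaWeight, RCLike.ofReal_mul, RCLike.ofReal_prod, hpair, Finset.prod_mul_distrib,
    modifiedWeight]
  rw [mul_assoc, ← Finset.prod_mul_distrib, ← Finset.prod_mul_distrib]
  congr 1
  simp only [← Finset.prod_mul_distrib]
  rw [Finset.prod_mul_distrib, prod_Ioi_mul_eq_prod_pow fun l => c (x l) ^ (β / 2)]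
  simp only [← pow_mul, mul_comm (β / 2), Finset.prod_mul_distrib]

theorem IsPhase.betaWeight_append (hc : IsPhase c) {β : ℕ} (hβ : Even β) (w : W → ℝ) {m n : ℕ}
    (y : Fin m → W) (x : Fin n → W) :
    ((betaWeight β w (Fin.append y x) : ℝ) : 𝕜) =
      (∏ j, ∏ k ∈ Finset.Ioi j, ((y k : 𝕜) - (y j : 𝕜)) ^ β) *
      (∏ l, modifiedWeight β (m + n) c w (y l)) *
      ((∏ l, ((∏ j, ((x l : 𝕜) - (y j : 𝕜)) ^ β) * modifiedWeight β (m + n) c w (x l))) *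
        ∏ j, ∏ k ∈ Finset.Ioi j, ((x k : 𝕜) - (x j : 𝕜)) ^ β) := by
  rw [hc.betaWeight_eq_prod hβ, prod_Ioi_append (fun a b : W => ((b : 𝕜) - (a : 𝕜)) ^ β),
    Fin.prod_univ_add]
  simp only [Fin.append_left, Fin.append_right, Finset.prod_mul_distrib]
  ring

theorem IsPhase.exists_norm_modifiedWeight_le (hc : IsPhase c) (β M : ℕ) (w : W → ℝ) :
    ∃ C : ℝ, ∀ x, ‖modifiedWeight β M c w x‖ ≤ C * |w x| := by
  obtain ⟨D, hD⟩ := hc.exists_norm_le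
  refine ⟨D ^ ((M - 1) * (β / 2)), fun x => ?_⟩
  rw [modifiedWeight, norm_mul, norm_pow, RCLike.norm_ofReal]
  gcongr
  exact hD x

end Phase

section GramIntegrability

open Polynomial

variable {𝕜 : Type*} [RCLike 𝕜] {W : Set 𝕜} {β N L m n : ℕ} {p : Fin N → 𝕜[X]}

theorem exists_norm_gramIntegrand_le (u : W → 𝕜) (hp : ∀ n, (p n).natDegree ≤ n) (y : Fin m → W)
    (t : Set.powersetCard (Fin N) L) :
    ∃ C : ℝ, ∀ x : W, ‖gramIntegrand β u p y t x‖ ≤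
      C * ((1 + ‖(x : 𝕜)‖) ^ (β * m + L * (N - L)) * ‖u x‖) := by
  obtain ⟨C, _, hC⟩ := exists_norm_eval_le (natDegree_wronskianPolynomial_le hp t)
  simp only [eval_wronskianPolynomial] at hC
  have hprod : ∀ x : W, ∏ j, ‖((x : 𝕜) - (y j : 𝕜)) ^ β‖ ≤
      (1 + ‖(x : 𝕜)‖) ^ (β * m) * ∏ j, (1 + ‖(y j : 𝕜)‖) ^ β := fun x => by
    calc ∏ j, ‖((x : 𝕜) - (y j : 𝕜)) ^ β‖
        ≤ ∏ j, ((1 + ‖(x : 𝕜)‖) * (1 + ‖(y j : 𝕜)‖)) ^ β := by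
          gcongr with j
          rw [norm_pow]
          gcongr
          exact norm_sub_le_one_add_mul _ _
      _ = _ := by
          simp only [mul_pow, Finset.prod_mul_distrib, Finset.prod_const, Finset.card_univ,
            Fintype.card_fin, pow_mul]
  refine ⟨(∏ j, (1 + ‖(y j : 𝕜)‖) ^ β) * C, fun x => ?_⟩
  calc ‖gramIntegrand β u p y t x‖
      = (∏ j, ‖((x : 𝕜) - (y j : 𝕜)) ^ β‖) * ‖_root_.wronskian p t (x : 𝕜)‖ * ‖u x‖ := by
        rw [gramIntegrand, norm_mul, norm_mul, norm_prod]
    _ ≤ ((1 + ‖(x : 𝕜)‖) ^ (β * m) * ∏ j, (1 + ‖(y j : 𝕜)‖) ^ β) *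
          (C * (1 + ‖(x : 𝕜)‖) ^ (L * (N - L))) * ‖u x‖ := by
        gcongr
        exacts [hprod x, hC x]
    _ = _ := by rw [pow_add]; ring

variable [MeasurableSpace W]

theorem measurable_gramIntegrand (hW : Measurable fun x : W => (x : 𝕜)) (β : ℕ) {u : W → 𝕜}
    (hu : Measurable u) (p : Fin N → 𝕜[X]) (y : Fin m → W) (t : Set.powersetCard (Fin N) L) :
    Measurable (gramIntegrand β u p y t) := by
  have hwronskian : Measurable fun x : W => _root_.wronskian p t (x : 𝕜) := by
    simp only [← eval_wronskianPolynomial]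
    exact (wronskianPolynomial p t).continuous.measurable.comp hW
  exact ((Finset.measurable_prod _ fun j _ => (hW.sub_const _).pow_const _).mul hwronskian).mul hu

variable {μ : Measure W}

theorem integrable_gramIntegrand (hW : Measurable fun x : W => (x : 𝕜)) {u : W → 𝕜}
    (hu : Measurable u) (hp : ∀ n, (p n).natDegree ≤ n) (y : Fin m → W)
    (t : Set.powersetCard (Fin N) L)
    (hmom : Integrable (fun x : W => (1 + ‖(x : 𝕜)‖) ^ (β * m + L * (N - L)) * ‖u x‖) μ) :
    Integrable (gramIntegrand β u p y t) μ := by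
  obtain ⟨C, hC⟩ := exists_norm_gramIntegrand_le (β := β) u hp y t
  exact (hmom.const_mul C).mono' (measurable_gramIntegrand hW β hu p y t).aestronglyMeasurable
    (.of_forall hC)

theorem IsPhase.integrable_gramIntegrand {c : W → 𝕜} (hc : IsPhase c)
    (hW : Measurable fun x : W => (x : 𝕜)) {w : W → ℝ} (hw : Measurable w)
    (hmom : Integrable (fun x : W => (1 + ‖(x : 𝕜)‖) ^ (L ^ 2 * (m + n - 1)) * w x) μ)
    {p : Fin (L * n) → 𝕜[X]} (hp : ∀ n, (p n).natDegree ≤ n) (y : Fin m → W)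
    (t : Set.powersetCard (Fin (L * n)) L) :
    Integrable (gramIntegrand (L ^ 2) (modifiedWeight (L ^ 2) (m + n) c w) p y t) μ := by
  have hexp : L ^ 2 * (m + n - 1) = L ^ 2 * m + L * (L * n - L) := by
    have hcard : L ≤ L * n := by
      simpa using Fintype.card_le_of_injective _ (Set.powersetCard.ofFinEmbEquiv.symm t).injective
    rcases n with _ | k
    · obtain rfl : L = 0 := by omega
      simp
    · rw [mul_add_one, Nat.add_sub_cancel, ← add_assoc, Nat.add_sub_cancel]
      ring
  obtain ⟨C, hC⟩ := hc.exists_norm_modifiedWeight_le (L ^ 2) (m + n) w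
  have hu : Measurable (modifiedWeight (L ^ 2) (m + n) c w) :=
    ((hc.measurable hW).pow_const _).mul (RCLike.measurable_ofReal.comp hw)
  refine _root_.integrable_gramIntegrand hW hu hp y t ((hmom.norm.const_mul C).mono'
    (((hW.norm.const_add 1).pow_const _).mul hu.norm).aestronglyMeasurable (.of_forall fun x => ?_))
  rw [hexp, norm_mul, norm_mul, norm_norm, Real.norm_eq_abs (w x), mul_left_comm]
  gcongr
  exact hC x

end GramIntegrability

section MarginalIsHyperpfaffian

variable {𝕜 : Type*} [RCLike 𝕜] {W : Set 𝕜} [MeasurableSpace W] {μ : Measure W} [SigmaFinite μ]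
  {w : W → ℝ} {m n : ℕ}

theorem integrable_betaWeight_append (hW : Measurable fun x : W => (x : 𝕜)) (hw : Measurable w)
    (hw0 : ∀ x, 0 ≤ w x) {β : ℕ}
    (hmom : Integrable (fun x : W => (1 + ‖(x : 𝕜)‖) ^ (β * (m + n - 1)) * w x) μ)
    (y : Fin m → W) :
    Integrable (fun x : Fin n → W => betaWeight β w (Fin.append y x)) (Measure.pi fun _ => μ) := by
  have happend : Measurable fun x : Fin n → W => Fin.append y x :=
    (measurePreserving_finAppend μ m n).measurable.comp measurable_prodMk_left
  have hprod := Integrable.fintype_prod (ι := Fin n)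
    (f := fun _ (x : W) => (1 + ‖(x : 𝕜)‖) ^ (β * (m + n - 1)) * w x) fun _ => hmom
  refine (hprod.const_mul (∏ l, ((1 + ‖(y l : 𝕜)‖) ^ (β * (m + n - 1)) * w (y l)))).mono'
    ((measurable_betaWeight hW β hw _).comp happend).aestronglyMeasurable
    (.of_forall fun x => ?_)
  rw [Real.norm_of_nonneg (betaWeight_nonneg β hw0 _)]
  refine (betaWeight_le_prod β hw0 _).trans_eq ?_
  simp only [Fin.prod_univ_add, Fin.append_left, Fin.append_right]

theorem hyperpfaffian_gramVector (β : ℕ) (u : W → 𝕜) {L : ℕ} {p : Fin (L * n) → Polynomial 𝕜}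
    (hp : IsCompleteMonicFamily p) {y : Fin m → W}
    (hint : ∀ t : Set.powersetCard (Fin (L * n)) L, Integrable (gramIntegrand β u p y t) μ) :
    hyperpfaffian (gramVector β u μ L p y) =
      (n ! : 𝕜)⁻¹ * ∫ x : Fin n → W, (∏ l, ((∏ j, ((x l : 𝕜) - (y j : 𝕜)) ^ β) * u (x l))) *
        ∏ j, ∏ k ∈ Finset.Ioi j, ((x k : 𝕜) - (x j : 𝕜)) ^ (L ^ 2) ∂(Measure.pi fun _ => μ) := by
  have hcomm : ∀ t : Set.powersetCard (Fin (L * n)) L, gramIntegrand β u p y t =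
      fun x : W => ((∏ j, ((x : 𝕜) - (y j : 𝕜)) ^ β) * u x) * wronskian p t (x : 𝕜) :=
    fun t => funext fun x => mul_right_comm _ _ _
  simp only [gramVector, hcomm] at hint ⊢
  exact hyperpfaffian_sum_integral_wronskian μ hp hint

theorem IsPhase.betaCorrelation_eq {c : W → 𝕜} (hc : IsPhase c) {L : ℕ} (hL : Even L)
    {p : Fin (L * n) → Polynomial 𝕜} (hp : IsCompleteMonicFamily p) {y : Fin m → W}
    (hint : ∀ t : Set.powersetCard (Fin (L * n)) L,
      Integrable (gramIntegrand (L ^ 2) (modifiedWeight (L ^ 2) (m + n) c w) p y t) μ) :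
    (betaCorrelation (L ^ 2) w μ m n y : 𝕜) = hyperpfaffianCorrelation L c w μ m n p y := by
  rw [hyperpfaffianCorrelation, hyperpfaffian_gramVector (L ^ 2) _ hp hint, betaCorrelation]
  simp only [jointDensity]
  rw [integral_const_mul, RCLike.ofReal_mul, RCLike.ofReal_mul, ← integral_ofReal]
  simp only [hc.betaWeight_append (hL.pow_of_ne_zero two_ne_zero)]
  rw [integral_const_mul]
  have hfac : ((m + n)! : 𝕜) ≠ 0 := Nat.cast_ne_zero.2 (Nat.factorial_ne_zero _)
  push_cast
  rw [mul_inv, div_eq_mul_inv]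
  field_simp

end MarginalIsHyperpfaffian

section Uniqueness

theorem ae_eq_restrict_pi_of_setLIntegral_eq {ι : Type*} [Finite ι] {α : ι → Type*}
    [∀ i, MeasurableSpace (α i)] {ν : Measure (∀ i, α i)} {f g : (∀ i, α i) → ℝ≥0∞}
    (hf : AEMeasurable f ν) (hg : AEMeasurable g ν) {B : ∀ i, Set (α i)}
    (hB : ∀ i, MeasurableSet (B i)) (hfin : ∫⁻ y in Set.univ.pi B, f y ∂ν ≠ ∞)
    (heq : ∀ C : ∀ i, Set (α i), (∀ i, MeasurableSet (C i)) → (∀ i, C i ⊆ B i) →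
      ∫⁻ y in Set.univ.pi C, f y ∂ν = ∫⁻ y in Set.univ.pi C, g y ∂ν) :
    f =ᵐ[ν.restrict (Set.univ.pi B)] g := by
  cases nonempty_fintype ι
  have hbox : ∀ C : ∀ i, Set (α i), (∀ i, MeasurableSet (C i)) →
      ∫⁻ y in Set.univ.pi C, f y ∂ν.restrict (Set.univ.pi B) =
        ∫⁻ y in Set.univ.pi C, g y ∂ν.restrict (Set.univ.pi B) := fun C hC => by
    rw [Measure.restrict_restrict (.univ_pi hC), ← Set.pi_inter_distrib]
    exact heq _ (fun i => (hC i).inter (hB i)) fun i => Set.inter_subset_right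
  refine (withDensity_eq_iff hf.restrict hg.restrict hfin).1 ?_
  have : IsFiniteMeasure ((ν.restrict (Set.univ.pi B)).withDensity f) :=
    isFiniteMeasure_withDensity hfin
  refine ext_of_generate_finite _ generateFrom_pi.symm isPiSystem_pi ?_ ?_
  · rintro _ ⟨C, hC, rfl⟩
    have hC' : ∀ i, MeasurableSet (C i) := fun i => hC i trivial
    simpa only [withDensity_apply _ (MeasurableSet.univ_pi hC')] using hbox C hC'
  · simpa only [withDensity_apply _ MeasurableSet.univ, Set.pi_univ] using
      hbox (fun _ => Set.univ) fun _ => .univ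

theorem lintegral_prod_occupation_lt_top {X : Type*} [MeasurableSpace X] {M m : ℕ}
    (P : Measure (Fin M → X)) [IsFiniteMeasure P] (B : Fin m → Set X) :
    ∫⁻ x, ∏ i, (occupation (B i) x : ℝ≥0∞) ∂P < ∞ := by
  classical
  have hle : ∀ x : Fin M → X, ∏ i, (occupation (B i) x : ℝ≥0∞) ≤ (M : ℝ≥0∞) ^ m := fun x => by
    have hcard : ∀ i, (occupation (B i) x : ℝ≥0∞) ≤ M := fun i => by
      exact_mod_cast (Finset.card_le_univ _).trans_eq (Fintype.card_fin M)
    simpa only [Finset.prod_const, Finset.card_univ, Fintype.card_fin] using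
      Finset.prod_le_prod' (s := .univ) fun i _ => hcard i
  exact (lintegral_mono hle).trans_lt <|
    lintegral_const_lt_top (ENNReal.pow_ne_top (ENNReal.natCast_ne_top M))

theorem exists_pairwise_disjoint_mem_countableBasis {X : Type*} [TopologicalSpace X] [T2Space X]
    [SecondCountableTopology X] {ι : Type*} [Finite ι] {y : ι → X} (hy : Function.Injective y) :
    ∃ b : ι → TopologicalSpace.countableBasis X,
      (Pairwise fun i j => Disjoint (b i : Set X) (b j)) ∧ ∀ i, y i ∈ (b i : Set X) := by
  obtain ⟨U, hU, hdisj⟩ := (Set.finite_range y).t2_separation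
  have hbasis : ∀ i, ∃ v : TopologicalSpace.countableBasis X, y i ∈ (v : Set X) ∧
      (v : Set X) ⊆ U (y i) := fun i => by
    obtain ⟨v, hv, hmem, hsub⟩ :=
      (TopologicalSpace.isBasis_countableBasis X).exists_subset_of_mem_open (hU (y i)).1
        (hU (y i)).2
    exact ⟨⟨v, hv⟩, hmem, hsub⟩
  choose b hmem hsub using hbasis
  exact ⟨b, fun i j hij => (hdisj ⟨i, rfl⟩ ⟨j, rfl⟩ (hy.ne hij)).mono (hsub i) (hsub j), hmem⟩

variable {X : Type*} [MeasurableSpace X] {μ : Measure X} {m M : ℕ} {P : Measure (Fin M → X)}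
  [IsFiniteMeasure P] {R S : (Fin m → X) → ℝ}

theorem IsCorrelationFunction.ae_eq_restrict_pi (hR : IsCorrelationFunction μ P m R)
    (hS : IsCorrelationFunction μ P m S) {B : Fin m → Set X} (hB : ∀ i, MeasurableSet (B i))
    (hdisj : Pairwise fun i j => Disjoint (B i) (B j)) :
    R =ᵐ[(Measure.pi fun _ => μ).restrict (Set.univ.pi B)] S := by
  have hofReal := ae_eq_restrict_pi_of_setLIntegral_eq (ν := Measure.pi fun _ => μ)
    hR.measurable.ennreal_ofReal.aemeasurable hS.measurable.ennreal_ofReal.aemeasurable hB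
    ((hR.expectation B hB hdisj).symm.trans_lt (lintegral_prod_occupation_lt_top P B)).ne
    fun C hC hCB => by
      have hCdisj : Pairwise fun i j => Disjoint (C i) (C j) := fun i j hij =>
        (hdisj hij).mono (hCB i) (hCB j)
      rw [← hR.expectation C hC hCdisj, ← hS.expectation C hC hCdisj]
  exact hofReal.mono fun y hy => (ENNReal.ofReal_eq_ofReal_iff (hR.nonneg y) (hS.nonneg y)).1 hy

theorem IsCorrelationFunction.ae_eq_of_injective [MeasurableSpace.CountablySeparated X]
    (hR : IsCorrelationFunction μ P m R) (hS : IsCorrelationFunction μ P m S) :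
    ∀ᵐ y ∂(Measure.pi fun _ => μ), Function.Injective y → R y = S y := by
  obtain ⟨_, _, _, _⟩ := exists_opensMeasurableSpace_of_countablySeparated X
  have hbox : ∀ᵐ y ∂(Measure.pi fun _ => μ), ∀ b : Fin m → TopologicalSpace.countableBasis X,
      (Pairwise fun i j => Disjoint (b i : Set X) (b j)) →
      y ∈ Set.univ.pi (fun i => (b i : Set X)) → R y = S y := by
    refine ae_all_iff.2 fun b => Filter.eventually_imp_distrib_left.2 fun hb => ?_
    have hmeas : ∀ i, MeasurableSet (b i : Set X) := fun i =>
      (TopologicalSpace.isOpen_of_mem_countableBasis (b i).2).measurableSet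
    exact (ae_restrict_iff' (.univ_pi hmeas)).1 (hR.ae_eq_restrict_pi hS hmeas hb)
  filter_upwards [hbox] with y hy hinj
  obtain ⟨b, hdisj, hmem⟩ := exists_pairwise_disjoint_mem_countableBasis hinj
  exact hy b hdisj fun i _ => hmem i

end Uniqueness

section BetaEnsemble

variable {𝕜 : Type*} [RCLike 𝕜] {W : Set 𝕜} [MeasurableSpace W] {w : W → ℝ} {μ : Measure W}
  {β M : ℕ}

theorem frequently_betaWeight_ne_zero_of_partitionFunction_ne_zero
    (hZ : partitionFunction β w μ M ≠ 0) :
    ∃ᵐ x ∂(Measure.pi fun _ : Fin M => μ), betaWeight β w x ≠ 0 := fun hzero =>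
  right_ne_zero_of_mul hZ (integral_eq_zero_of_ae (hzero.mono fun _ => not_not.1))

theorem isFiniteMeasure_betaEnsemble
    (hint : Integrable (fun x : Fin M → W => betaWeight β w x) (Measure.pi fun _ => μ)) :
    IsFiniteMeasure (betaEnsemble β w μ M) :=
  isFiniteMeasure_withDensity_ofReal (hint.const_mul _).2

theorem isCorrelationFunction_betaCorrelation [SigmaFinite μ] {m n : ℕ}
    (hW : Measurable fun x : W => (x : 𝕜)) (hw : Measurable w) (hw0 : ∀ x, 0 ≤ w x)
    (hint : Integrable (fun x : Fin (m + n) → W => betaWeight β w x) (Measure.pi fun _ => μ)) :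
    IsCorrelationFunction μ (betaEnsemble β w μ (m + n)) m (betaCorrelation β w μ m n) := by
  have hZ : 0 ≤ partitionFunction β w μ (m + n) :=
    mul_nonneg (by positivity) (integral_nonneg fun x => betaWeight_nonneg β hw0 x)
  exact isCorrelationFunction_marginal μ ((measurable_betaWeight hW β hw _).const_mul _)
    (fun x => mul_nonneg (by positivity) (betaWeight_nonneg β hw0 x))
    (fun τ x => congrArg (_ * ·) (betaWeight_comp_perm β w x τ)) (hint.const_mul _)

end BetaEnsemble

end

theorem mainTheorem1 {𝕜 : Type*} [RCLike 𝕜] {W : Set 𝕜} [MeasurableSpace W]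
    -- the σ-algebra of `W` contains the Borel sets
    (hW : @Measurable W 𝕜 _ (borel 𝕜) Subtype.val)
    (μ : Measure W) [SigmaFinite μ]
    (c : W → 𝕜)
    (hc : ∀ x y : W, ((‖(x : 𝕜) - (y : 𝕜)‖ ^ 2 : ℝ) : 𝕜) = c x * c y * ((x : 𝕜) - (y : 𝕜)) ^ 2)
    (w : W → ℝ) (hw : Measurable w) (hw0 : ∀ x, 0 ≤ w x)
    -- charge `L`, `β = L ^ 2`, and `M = m + M'` particles
    (L : ℕ) (hL : Even L) (hLpos : 0 < L) (m M' : ℕ) (hm : 1 ≤ m)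
    -- `0 < Z < ∞`
    (hZfin : Integrable (fun x : Fin (m + M') → W => betaWeight (L ^ 2) w x)
      (Measure.pi fun _ => μ))
    (hZpos : 0 < partitionFunction (L ^ 2) w μ (m + M'))
    (p : Fin (L * M') → Polynomial 𝕜) (hp : IsCompleteMonicFamily p) :
    -- all the integrals converge
    (∀ y : Fin m → W,
      Integrable (fun x : Fin M' → W => jointDensity (L ^ 2) w μ (Fin.append y x))
        (Measure.pi fun _ => μ) ∧
      ∀ t : Set.powersetCard (Fin (L * M')) L,
        Integrable (gramIntegrand (L ^ 2) (modifiedWeight (L ^ 2) (m + M') c w) p y t) μ) ∧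
    -- the marginal density is an `m`-th correlation function and is given by the hyperpfaffian
    IsCorrelationFunction μ (betaEnsemble (L ^ 2) w μ (m + M')) m
      (betaCorrelation (L ^ 2) w μ m M') ∧
    (∀ y : Fin m → W,
      (betaCorrelation (L ^ 2) w μ m M' y : 𝕜) = hyperpfaffianCorrelation L c w μ m M' p y) ∧
    -- every `m`-th correlation function is given by the hyperpfaffian, almost everywhere on the
    -- configurations of distinct points (the only ones that its definition sees)
    (∀ R : (Fin m → W) → ℝ,
      IsCorrelationFunction μ (betaEnsemble (L ^ 2) w μ (m + M')) m R →
      ∀ᵐ y ∂(Measure.pi fun _ => μ), Function.Injective y →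
        (R y : 𝕜) = hyperpfaffianCorrelation L c w μ m M' p y) := by
  have hc : IsPhase c := hc
  have hmom := integrable_one_add_norm_pow_mul_weight hW (pow_ne_zero 2 hLpos.ne')
    (Nat.add_pos_left hm M').ne' hw hZfin
    (frequently_betaWeight_ne_zero_of_partitionFunction_ne_zero hZpos.ne')
  have hgram := hc.integrable_gramIntegrand hW hw hmom fun n => (hp n).2.le
  have hformula := fun y => hc.betaCorrelation_eq hL hp (hgram y)
  have hcorr := isCorrelationFunction_betaCorrelation hW hw hw0 hZfin
  refine ⟨fun y => ⟨(integrable_betaWeight_append hW hw hw0 hmom y).const_mul _, hgram y⟩, hcorr,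
    hformula, fun R hR => ?_⟩
  have : IsFiniteMeasure (betaEnsemble (L ^ 2) w μ (m + M')) := isFiniteMeasure_betaEnsemble hZfin
  have : MeasurableSpace.CountablySeparated W := .mono hW.comap_le
  filter_upwards [hR.ae_eq_of_injective hcorr] with y hy hinj
  rw [hy hinj, hformula]
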